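/- All graphs are finite and simple. For a graph $G$ and $X\subseteq V(G)$ let $N_G(X)=\bigcup_{x\in X}N_G(x)$, and let $$bind(G)=\min\Big\{\frac{|N_G(X)|}{|X|}:\ \emptyset\neq X\subseteq V(G),\ N_G(X)\neq V(G)\Big\}$$ be the binding number of $G$. For positive integers $a\le b$, a fractional $[a,b]$-factor of a graph $H$ is given by an indicator function $h:E(H)\to[0,1]$ such that $a\le\sum_{e\ni x}h(e)\le b$ for every $x\in V(H)$. The graph $H$ is fractional $[a,b]$-covered if it has a fractional $[a,b]$-factor and, for every edge $e\in E(H)$, it has a fractional $[a,b]$-factor whose indicator function $h$ (which may depend on $e$) satisfies $h(e)=1$. A graph $G$ is fractional ID-$[a,b]$-factor-critical covered if, for every independent set $I$ of $G$ (including $I=\emptyset$), the graph $G-I$ is fractional $[a,b]$-covered. Theorem 2. Let $a,b$ be integers with $2\le a\le b$, and let $G$ be a graph of order $n\ge\frac{(a+2b)(a+b-2)+2}{b}$. If $bind(G)>\frac{(a+2b-1)(n-1)}{bn-(a+b)}$, then $G$ is fractional ID-$[a,b]$-factor-critical covered. -/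

import Mathlib

namespace FracCovered

/-- The neighbourhood `N_G(X)` of a set `X` of vertices: the union of the neighbourhoods `N_G(x)`,
`x ∈ X`. -/
def setNeighborhood {V : Type*} (G : SimpleGraph V) (X : Set V) : Set V :=
  ⋃ x ∈ X, G.neighborSet x

/-- The ratios `|N_G(X)| / |X|` over all nonempty `X` with `N_G(X) ≠ V(G)`. -/
def bindingRatios {V : Type*} (G : SimpleGraph V) : Set ℝ :=
  {r | ∃ X : Set V, X.Nonempty ∧ setNeighborhood G X ≠ Set.univ ∧
    r = ((setNeighborhood G X).ncard : ℝ) / (X.ncard : ℝ)}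

/-- The binding number of a finite graph: the least of the ratios `|N_G(X)| / |X|` over all
nonempty `X` with `N_G(X) ≠ V(G)`. The infimum is attained as soon as `V` is nonempty,
see `isLeast_bindingNumber`. -/
noncomputable def bindingNumber {V : Type*} (G : SimpleGraph V) : ℝ :=
  sInf (bindingRatios G)

/-- On a nonempty finite vertex set the binding number is a genuine minimum. -/
theorem isLeast_bindingNumber {V : Type*} [Finite V] [Nonempty V] (G : SimpleGraph V) :
    IsLeast (bindingRatios G) (bindingNumber G) := by
  have hfin : (bindingRatios G).Finite := by
    refine (Set.finite_range (fun X : Set V =>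
      ((setNeighborhood G X).ncard : ℝ) / (X.ncard : ℝ))).subset ?_
    rintro r ⟨X, -, -, rfl⟩
    exact ⟨X, rfl⟩
  have hne : (bindingRatios G).Nonempty := by
    obtain ⟨v⟩ := ‹Nonempty V›
    refine ⟨_, {v}, Set.singleton_nonempty v, ?_, rfl⟩
    intro h
    have hv : v ∈ setNeighborhood G {v} := by rw [h]; trivial
    simp [setNeighborhood] at hv
  exact ⟨hne.csInf_mem hfin, fun r hr => csInf_le hfin.bddBelow hr⟩

open Classical in
/-- `h` is the indicator function of a fractional `[a,b]`-factor of `G`: it takes values in `[0,1]`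
on the edges of `G`, and at each vertex `x` the sum of `h e` over the edges `e` of `G` that contain
`x` lies between `a` and `b`. (Values of `h` outside the edge set of `G` play no role.) -/
def IsFractionalFactor {V : Type*} [Fintype V] (G : SimpleGraph V) (a b : ℕ)
    (h : Sym2 V → ℝ) : Prop :=
  (∀ e ∈ G.edgeSet, 0 ≤ h e ∧ h e ≤ 1) ∧
    ∀ x : V, (a : ℝ) ≤ ∑ e ∈ G.incidenceFinset x, h e ∧
      ∑ e ∈ G.incidenceFinset x, h e ≤ (b : ℝ)

/-- `G` is fractional `[a,b]`-covered: it has a fractional `[a,b]`-factor, and for every edge `e`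
it has one whose indicator function has value `1` at `e`. (The first clause follows from the second
when `G` has an edge.) -/
def IsFractionalCovered {V : Type*} [Fintype V] (G : SimpleGraph V) (a b : ℕ) : Prop :=
  (∃ h : Sym2 V → ℝ, IsFractionalFactor G a b h) ∧
    ∀ e ∈ G.edgeSet, ∃ h : Sym2 V → ℝ, IsFractionalFactor G a b h ∧ h e = 1

open Classical in
/-- `G` is fractional ID-`[a,b]`-factor-critical covered: for every independent set `I` of `G`,
the graph `G - I` (induced on the complement of `I`) is fractional `[a,b]`-covered. -/
def IsFractionalIDFactorCriticalCovered {V : Type*} [Fintype V] (G : SimpleGraph V)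
    (a b : ℕ) : Prop :=
  ∀ I : Set V, G.IsIndepSet I →
    IsFractionalCovered (G.induce (Iᶜ : Set V)) a b

end FracCovered

/-! A factor with value `1` on `e₀` exists iff the convex set of degree vectors of admissible edge
weightings meets the box `[a,b]^V`. If it does not, a separating functional gives vertex weights `w`
with negative `surplus`. The surplus splits additively when a multiple of the sign pattern of `w` is
removed, so weights in `{-1, 0, 1}` suffice (`surplus_nonneg_of_sign`). Such weights are pairs of
disjoint sets `S` (weight `-1`) and `T` (weight `1`), which yields the cut condition of
`isFractionalCovered_of_cut`.

For `G - I` this condition follows from the binding number (`cut_of_bindingNumber`). The bound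
forces large degrees, hence small independent sets. Let `h` be the least degree outside `I ∪ S` of a
vertex of `T`. If `h ≥ a`, the condition is immediate. If `1 ≤ h < a`, the degree bounds make `S`
large enough (`cut_arith_pos`). If `h = 0`, the vertices of `T` isolated outside `I ∪ S` are few, by
the binding number again (`cut_arith_zero`). -/

namespace FracCovered

/-! ### Duality for fractional factors -/

/-- The function on edges which a family of vertex weights maximises: `x` on a forced edge,
the positive part of `x` otherwise. -/
noncomputable def edgeGain (forced : Prop) [Decidable forced] (x : ℝ) : ℝ :=
  if forced then x else max x 0

open Classical in
/-- Maximal weighted degree sum minus minimal weighted demand; a negative value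
certifies that there is no fractional `[a,b]`-factor with value `1` on `e₀`. -/
noncomputable def surplus {V : Type*} [Fintype V] (G : SimpleGraph V) (a b : ℝ) (e₀ : Sym2 V)
    (w : V → ℝ) : ℝ :=
  (∑ u, ∑ v ∈ G.neighborFinset u, edgeGain (s(u, v) = e₀) (w u + w v)) / 2
    - ∑ v, min (a * w v) (b * w v)

open Classical in
theorem sum_incidenceFinset_eq {V : Type*} [Fintype V] (G : SimpleGraph V) (h : Sym2 V → ℝ)
    (x : V) : ∑ e ∈ G.incidenceFinset x, h e = ∑ v ∈ G.neighborFinset x, h s(x, v) := by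
  symm
  refine Finset.sum_bij (fun v _ => s(x, v)) ?_ ?_ ?_ ?_
  · intro v hv
    simpa [SimpleGraph.mem_incidenceFinset, SimpleGraph.mk'_mem_incidenceSet_iff] using hv
  · intro v _ v' _ hvv
    exact Sym2.congr_right.mp hvv
  · intro e he
    induction e using Sym2.ind with
    | _ p q =>
      rw [SimpleGraph.mem_incidenceFinset, SimpleGraph.mk'_mem_incidenceSet_iff] at he
      obtain ⟨hpq, rfl | rfl⟩ := he
      · exact ⟨q, by simpa using hpq, rfl⟩
      · exact ⟨p, by simpa using hpq.symm, Sym2.eq_swap⟩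
  · intros; rfl

open Classical in
theorem sum_neighborFinset_comm {V : Type*} [Fintype V] (G : SimpleGraph V) (g : V → V → ℝ) :
    ∑ u, ∑ v ∈ G.neighborFinset u, g u v = ∑ u, ∑ v ∈ G.neighborFinset u, g v u :=
  Finset.sum_comm' (by simp [SimpleGraph.adj_comm])

open Classical in
/-- Separation of the degree vectors from the box `[a,b]^V`. -/
theorem exists_fractionalFactor_of_surplus_nonneg {V : Type*} [Fintype V] (G : SimpleGraph V)
    (a b : ℕ) (hab : a ≤ b) (e₀ : Sym2 V) (hsur : ∀ w, 0 ≤ surplus G a b e₀ w) :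
    ∃ h : Sym2 V → ℝ, IsFractionalFactor G a b h ∧ h e₀ = 1 := by
  let L : (Sym2 V → ℝ) →ₗ[ℝ] (V → ℝ) :=
    LinearMap.pi fun u => ∑ v ∈ G.neighborFinset u, LinearMap.proj s(u, v)
  have hL : ∀ h u, L h u = ∑ v ∈ G.neighborFinset u, h s(u, v) := by
    intro h u; simp [L]
  let P : Set (Sym2 V → ℝ) := Set.univ.pi fun e => if e = e₀ then {1} else Set.Icc 0 1
  have hPconv : Convex ℝ P := convex_pi fun e _ => by
    split_ifs
    exacts [convex_singleton _, convex_Icc _ _]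
  have hPcomp : IsCompact P := isCompact_univ_pi fun e => by
    split_ifs
    exacts [isCompact_singleton, isCompact_Icc]
  let Q : Set (V → ℝ) := Set.Icc (fun _ => (a : ℝ)) (fun _ => (b : ℝ))
  by_cases hdisj : Disjoint (L '' P) Q
  · exfalso
    obtain ⟨f, u, v, h1, huv, h2⟩ := geometric_hahn_banach_compact_closed
      (hPconv.linear_image L) (hPcomp.image L.continuous_of_finiteDimensional)
      (convex_Icc _ _) isClosed_Icc hdisj
    let w : V → ℝ := fun x => f (Pi.single x 1)
    have hf : ∀ x : V → ℝ, f x = ∑ v, x v * w v := fun x => by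
      conv_lhs => rw [pi_eq_sum_univ' x, map_sum]
      simp only [map_smul, smul_eq_mul, w]
    let W : Sym2 V → ℝ := Sym2.lift ⟨fun p q => w p + w q, fun p q => add_comm _ _⟩
    -- `h` maximises the separating functional over the admissible weightings, and `y` below
    -- minimises it over the box.
    let h : Sym2 V → ℝ := fun e => if e = e₀ then 1 else if 0 ≤ W e then 1 else 0
    have hP : h ∈ P := by
      intro e _
      dsimp only [h]
      split_ifs <;> simp
    let y : V → ℝ := fun v => if 0 ≤ w v then a else b
    have hab' : (a : ℝ) ≤ b := by exact_mod_cast hab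
    have hy : y ∈ Q := by
      constructor <;> intro v <;> dsimp only [y] <;> split_ifs <;> simp [hab']
    have hlt : f (L h) < f y := (h1 _ ⟨h, hP, rfl⟩).trans (huv.trans (h2 _ hy))
    have hfy : f y = ∑ v, min (a * w v) (b * w v) := by
      rw [hf]
      refine Finset.sum_congr rfl fun v _ => ?_
      dsimp only [y]
      split_ifs with hv
      · rw [min_eq_left (mul_le_mul_of_nonneg_right hab' hv)]
      · rw [min_eq_right (mul_le_mul_of_nonpos_right hab' (not_le.mp hv).le)]
    have hfL : f (L h) =
        (∑ u, ∑ v ∈ G.neighborFinset u, edgeGain (s(u, v) = e₀) (w u + w v)) / 2 := by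
      have e1 : f (L h) = ∑ u, ∑ v ∈ G.neighborFinset u, h s(u, v) * w u := by
        rw [hf]
        refine Finset.sum_congr rfl fun u _ => ?_
        rw [hL, Finset.sum_mul]
      have e2 : f (L h) = ∑ u, ∑ v ∈ G.neighborFinset u, h s(u, v) * w v := by
        rw [e1, sum_neighborFinset_comm]
        simp only [Sym2.eq_swap]
      have e3 : ∑ u, ∑ v ∈ G.neighborFinset u, edgeGain (s(u, v) = e₀) (w u + w v) =
          f (L h) + f (L h) := by
        nth_rw 1 [e1]
        rw [e2, ← Finset.sum_add_distrib]
        refine Finset.sum_congr rfl fun u _ => ?_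
        rw [← Finset.sum_add_distrib]
        refine Finset.sum_congr rfl fun v _ => ?_
        have hW : W s(u, v) = w u + w v := rfl
        dsimp only [h, edgeGain]
        rw [hW]
        split_ifs with h1 h2
        · ring
        · rw [max_eq_left h2]; ring
        · rw [max_eq_right (not_le.mp h2).le]; ring
      rw [e3]; ring
    have := hsur w
    unfold surplus at this
    linarith
  · rw [Set.not_disjoint_iff] at hdisj
    obtain ⟨_, ⟨h, hP, rfl⟩, hQ⟩ := hdisj
    have he₀ : h e₀ = 1 := by simpa using hP e₀ trivial
    refine ⟨h, ⟨fun e _ => ?_, fun x => ?_⟩, he₀⟩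
    · by_cases he : e = e₀
      · subst he; rw [he₀]; norm_num
      · have := hP e trivial
        simpa [he] using this
    · have := sum_incidenceFinset_eq G h x
      rw [this, ← hL]
      exact ⟨hQ.1 x, hQ.2 x⟩

/-! ### Reduction to sign weights -/

/-- Since `m` is at most every nonzero absolute value, the sum of signs and the sum of remainders
never have opposite signs, and the positive part is additive on such pairs. -/
theorem edgeGain_peel (forced : Prop) [Decidable forced] {m x y : ℝ} (hm : 0 < m)
    (hx : x ≠ 0 → m ≤ |x|) (hy : y ≠ 0 → m ≤ |y|) :
    edgeGain forced (x + y) = m * edgeGain forced (SignType.sign x + SignType.sign y : ℝ) +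
      edgeGain forced ((x - m * SignType.sign x) + (y - m * SignType.sign y)) := by
  unfold edgeGain
  split_ifs
  · ring
  · rcases lt_trichotomy x 0 with h | h | h <;> rcases lt_trichotomy y 0 with h' | h' | h' <;>
      simp only [h, h', sign_neg, sign_pos, sign_zero, SignType.coe_neg_one, SignType.coe_one,
        SignType.coe_zero] <;>
      (try have hx := hx h.ne) <;> (try have hx := hx h.ne') <;>
      (try have hy := hy h'.ne) <;> (try have hy := hy h'.ne') <;>
      (try rw [abs_of_neg h] at hx) <;> (try rw [abs_of_pos h] at hx) <;>
      (try rw [abs_of_neg h'] at hy) <;> (try rw [abs_of_pos h'] at hy) <;>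
      norm_num <;> grind

theorem min_mul_peel {a b m x : ℝ} (hab : a ≤ b) (hx : x ≠ 0 → m ≤ |x|) :
    min (a * x) (b * x) = m * min (a * SignType.sign x) (b * SignType.sign x) +
      min (a * (x - m * SignType.sign x)) (b * (x - m * SignType.sign x)) := by
  rcases lt_trichotomy x 0 with h | h | h
  · have := hx h.ne
    rw [abs_of_neg h] at this
    simp only [h, sign_neg, SignType.coe_neg_one]
    rw [min_eq_right, min_eq_right, min_eq_right] <;> nlinarith
  · subst h; simp
  · have := hx h.ne'
    rw [abs_of_pos h] at this
    simp only [h, sign_pos, SignType.coe_one]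
    rw [min_eq_left, min_eq_left, min_eq_left] <;> nlinarith

open Classical in
theorem surplus_peel {V : Type*} [Fintype V] (G : SimpleGraph V) {a b m : ℝ} (hab : a ≤ b)
    (e₀ : Sym2 V) (w : V → ℝ) (hm : 0 < m) (hw : ∀ v, w v ≠ 0 → m ≤ |w v|) :
    surplus G a b e₀ w = m * surplus G a b e₀ (fun v => (SignType.sign (w v) : ℝ)) +
      surplus G a b e₀ (fun v => w v - m * SignType.sign (w v)) := by
  unfold surplus
  rw [Finset.sum_congr rfl fun u _ => Finset.sum_congr rfl fun v _ =>
      edgeGain_peel (s(u, v) = e₀) hm (hw u) (hw v),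
    Finset.sum_congr rfl fun v _ => min_mul_peel hab (hw v)]
  simp only [Finset.sum_add_distrib, ← Finset.mul_sum]
  ring

open Classical in
/-- It suffices to test weights with values in `{-1, 0, 1}`. -/
theorem surplus_nonneg_of_sign {V : Type*} [Fintype V] (G : SimpleGraph V) {a b : ℝ} (hab : a ≤ b)
    (e₀ : Sym2 V) (hs : ∀ s : V → SignType, 0 ≤ surplus G a b e₀ (fun v => (s v : ℝ)))
    (w : V → ℝ) : 0 ≤ surplus G a b e₀ w := by
  induction hk : (Finset.univ.filter fun v => w v ≠ 0).card using Nat.strong_induction_on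
    generalizing w with
  | _ k ih =>
    by_cases hne : (Finset.univ.filter fun v => w v ≠ 0).Nonempty
    · obtain ⟨v₀, hv₀, hmin⟩ := Finset.exists_min_image _ (fun v => |w v|) hne
      have hv₀' : w v₀ ≠ 0 := by simpa using hv₀
      have hm : 0 < |w v₀| := abs_pos.mpr hv₀'
      rw [surplus_peel G hab e₀ w hm fun v hv => hmin v (by simpa using hv)]
      -- With `m` the least nonzero absolute value, the remainder vanishes at `v₀` and gains no
      -- support.
      refine add_nonneg (mul_nonneg hm.le (hs _)) (ih _ ?_ _ rfl)
      rw [← hk]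
      refine Finset.card_lt_card (Finset.ssubset_iff_of_subset ?_ |>.mpr ⟨v₀, hv₀, ?_⟩)
      · intro v
        simp only [Finset.mem_filter, Finset.mem_univ, true_and]
        intro h h0
        exact h (by simp [h0])
      · simp
    · have h0 : ∀ v, w v = 0 := fun v => by
        by_contra h
        exact hne ⟨v, by simpa using h⟩
      have : w = fun v => (((fun _ => 0 : V → SignType) v : SignType) : ℝ) := by
        funext v; simp [h0 v]
      rw [this]
      exact hs _

/-! ### The cut condition -/

open Classical in
/-- A cut condition which is sufficient for a graph to be fractional `[a,b]`-covered. -/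
theorem isFractionalCovered_of_cut {V : Type*} {_ : Fintype V} (G : SimpleGraph V) (a b : ℕ)
    (hab : a ≤ b)
    (hcut : ∀ S T : Finset V, Disjoint S T →
      a * T.card + (if S.Nonempty then 2 else 0) ≤
        b * S.card + ∑ x ∈ T, (G.neighborFinset x \ S).card) :
    IsFractionalCovered G a b := by
  have key : ∀ e₀ : Sym2 V, ∃ h : Sym2 V → ℝ, IsFractionalFactor G a b h ∧ h e₀ = 1 := by
    intro e₀
    refine exists_fractionalFactor_of_surplus_nonneg G a b hab e₀
      (surplus_nonneg_of_sign G (by exact_mod_cast hab) e₀ fun s => ?_)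
    set S := Finset.univ.filter fun v => s v = -1 with hS
    set T := Finset.univ.filter fun v => s v = 1 with hT
    have hST : Disjoint S T := by
      rw [Finset.disjoint_left]
      intro v hv hv'
      simp only [hS, hT, Finset.mem_filter, Finset.mem_univ, true_and] at hv hv'
      rw [hv] at hv'
      exact absurd hv' (by decide)
    -- The forced edge costs most when both ends lie in `S`: it contributes `-2` where a free edge
    -- would contribute `0`. With `S` empty it costs nothing.
    set ε : ℝ := if S.Nonempty then 2 else 0 with hε
    have hε0 : 0 ≤ ε := by rw [hε]; split_ifs <;> norm_num
    have hc : (a : ℝ) * T.card + ε ≤ b * S.card + ∑ x ∈ T, ((G.neighborFinset x \ S).card : ℝ) := by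
      have := hcut S T hST
      rw [hε]
      split_ifs at this ⊢ <;> exact_mod_cast this
    have hdem : ∑ v, min ((a : ℝ) * s v) (b * s v) = a * T.card - b * S.card := by
      have h1 : ∀ v, min ((a : ℝ) * s v) (b * s v) =
          a * (if s v = 1 then 1 else 0) - b * (if s v = -1 then 1 else 0) := by
        intro v
        have : (a : ℝ) ≤ b := by exact_mod_cast hab
        cases s v <;> simp [this]
      simp_rw [h1, Finset.sum_sub_distrib, ← Finset.mul_sum]
      simp [hS, hT]
    have hpair : ∑ u, ∑ v ∈ G.neighborFinset u, (if s(u, v) = e₀ then (1 : ℝ) else 0) ≤ 2 := by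
      induction e₀ using Sym2.ind with
      | _ p q =>
        calc ∑ u, ∑ v ∈ G.neighborFinset u, (if s(u, v) = s(p, q) then (1 : ℝ) else 0)
            ≤ ∑ u, ∑ v, ((if u = p then (1 : ℝ) else 0) * (if v = q then 1 else 0) +
                (if u = q then (1 : ℝ) else 0) * (if v = p then 1 else 0)) := by
              refine Finset.sum_le_sum fun u _ => ?_
              refine (Finset.sum_le_sum_of_subset_of_nonneg (Finset.subset_univ _)
                fun v _ _ => by split_ifs <;> norm_num).trans (Finset.sum_le_sum fun v _ => ?_)
              simp only [Sym2.eq_iff]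
              by_cases h1 : u = p <;> by_cases h2 : v = q <;> by_cases h3 : u = q <;>
                by_cases h4 : v = p <;> simp [h1, h2, h3, h4] <;> grind
          _ = 2 := by
              simp [Finset.sum_add_distrib]
              norm_num
    have hgain : ∀ u v, (if u ∈ T ∧ v ∉ S then (1 : ℝ) else 0) + (if v ∈ T ∧ u ∉ S then 1 else 0) -
        ε * (if s(u, v) = e₀ then 1 else 0) ≤ edgeGain (s(u, v) = e₀) (s u + s v : ℝ) := by
      intro u v
      have hSε : S.Nonempty → ε = 2 := fun h => by rw [hε, if_pos h]
      have hu : s u = -1 → ε = 2 := fun h => hSε ⟨u, by simp [hS, h]⟩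
      have hv : s v = -1 → ε = 2 := fun h => hSε ⟨v, by simp [hS, h]⟩
      simp only [hS, hT, Finset.mem_filter, Finset.mem_univ, true_and, edgeGain]
      clear_value ε
      generalize s u = x at *
      generalize s v = y at *
      by_cases he : s(u, v) = e₀ <;> simp only [he, if_true, if_false] <;>
        cases x <;> cases y <;> simp at hu hv ⊢ <;> linarith
    have hsum : ∑ u, ∑ v ∈ G.neighborFinset u, (if u ∈ T ∧ v ∉ S then (1 : ℝ) else 0) =
        ∑ x ∈ T, ((G.neighborFinset x \ S).card : ℝ) := by
      rw [← Finset.sum_filter_add_sum_filter_not Finset.univ (· ∈ T)]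
      rw [Finset.sum_eq_zero (s := Finset.univ.filter fun u => u ∉ T), add_zero]
      · simp only [Finset.filter_mem_eq_inter, Finset.univ_inter]
        refine Finset.sum_congr rfl fun u hu => ?_
        simp only [hu, true_and]
        rw [Finset.sum_boole, Finset.sdiff_eq_filter]
      · intro u hu
        have : u ∉ T := by simpa using hu
        simp [this]
    have htot := Finset.sum_le_sum fun u (_ : u ∈ Finset.univ) =>
      Finset.sum_le_sum fun v (_ : v ∈ G.neighborFinset u) => hgain u v
    simp only [Finset.sum_sub_distrib, Finset.sum_add_distrib, ← Finset.mul_sum] at htot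
    rw [sum_neighborFinset_comm G fun u v => if v ∈ T ∧ u ∉ S then (1 : ℝ) else 0, hsum] at htot
    unfold surplus
    rw [hdem]
    nlinarith [mul_le_mul_of_nonneg_left hpair hε0]
  refine ⟨?_, fun e _ => key e⟩
  rcases isEmpty_or_nonempty V with hV | ⟨⟨v⟩⟩
  · exact ⟨0, fun e _ => by simp, fun x => isEmptyElim x⟩
  -- A diagonal pair is never an edge, so forcing it imposes nothing.
  · obtain ⟨h, hh, -⟩ := key s(v, v)
    exact ⟨h, hh⟩

/-! ### Consequences of the binding number -/

open Classical in
theorem bindingNumber_mul_card_le {V : Type*} [Fintype V] (G : SimpleGraph V) {X Y : Finset V}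
    (hX : X.Nonempty) (hY : Y.Nonempty) (hXY : ∀ x ∈ X, ∀ y ∈ Y, ¬ G.Adj x y) :
    bindingNumber G * X.card ≤ Fintype.card V - Y.card := by
  have hsub : setNeighborhood G (X : Set V) ⊆ ((Yᶜ : Finset V) : Set V) := by
    intro v hv
    simp only [setNeighborhood, Set.mem_iUnion, SimpleGraph.mem_neighborSet] at hv
    obtain ⟨x, hx, hxv⟩ := hv
    simp only [Finset.coe_compl, Set.mem_compl_iff, Finset.mem_coe]
    exact fun hvY => hXY x hx v hvY hxv
  have hne : setNeighborhood G (X : Set V) ≠ Set.univ := by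
    obtain ⟨y, hy⟩ := hY
    intro h
    have := hsub (h ▸ Set.mem_univ y)
    simp [hy] at this
  have : Nonempty V := ⟨hX.choose⟩
  have hle := (isLeast_bindingNumber G).2 ⟨(X : Set V), by simpa using hX, hne, rfl⟩
  have hXpos : (0 : ℝ) < X.card := by exact_mod_cast hX.card_pos
  rw [Set.ncard_coe_finset, le_div_iff₀ hXpos] at hle
  refine hle.trans ?_
  have := Set.ncard_le_ncard hsub
  rw [Set.ncard_coe_finset, Finset.card_compl] at this
  have h2 : Y.card ≤ Fintype.card V := Finset.card_le_univ Y
  rw [← Nat.cast_sub h2]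
  exact_mod_cast this

open Classical in
theorem bindingNumber_mul_sub_degree_le {V : Type*} [Fintype V] (G : SimpleGraph V) (x : V) :
    bindingNumber G * (Fintype.card V - (G.neighborFinset x).card) ≤ Fintype.card V - 1 := by
  -- The non-neighbours of `x`, including `x` itself, have no edge to `x`.
  have h := bindingNumber_mul_card_le G (X := (G.neighborFinset x)ᶜ) (Y := {x})
    ⟨x, by simp⟩ (Finset.singleton_nonempty x) (by
      intro y hy z hz hadj
      rw [Finset.mem_singleton] at hz
      subst hz
      exact Finset.mem_compl.mp hy (by simpa using hadj.symm))
  rwa [Finset.card_compl, Nat.cast_sub (Finset.card_le_univ _), Finset.card_singleton,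
    Nat.cast_one] at h

/-! ### Arithmetic of the bounds -/

/-- The arithmetic contradiction when the least degree outside the cut is `h ≥ 1`. -/
theorem cut_arith_pos {a b n i s h : ℝ} (ha : 2 ≤ a) (hab : a ≤ b) (h1 : 1 ≤ h) (hha : h ≤ a)
    (hn : (a + 2 * b) * (a + b - 2) + 2 ≤ b * n)
    (hi : (a + 2 * b - 1) * i < b * n - (a + b))
    (hd : (a + b - 1) * n + (a + b) < (a + 2 * b - 1) * (h + s + i)) :
    1 < b * s - (a - h) * (n - i - s) := by
  have hD : 0 < a + 2 * b - 1 := by linarith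
  have k1 := mul_lt_mul_of_pos_left hd (show 0 < a + b - h by linarith)
  have k2 := mul_lt_mul_of_pos_left hi (show 0 < b by linarith)
  have k3 := mul_le_mul_of_nonneg_left hn (show 0 ≤ h - 1 by linarith)
  -- After `k1`, `k2`, `k3` exactly `(h - 1)² (a + 2b - 1)` is left over; at `h = 1` the order `n`
  -- drops out.
  have k4 := mul_nonneg (sq_nonneg (h - 1)) hD.le
  refine lt_of_mul_lt_mul_left (a := a + 2 * b - 1) ?_ hD.le
  linarith

/-- Makes the coefficient of `n - i - s` nonpositive in `cut_arith_zero`, so that the upper bound on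
that quantity can be inserted. -/
theorem cut_arith_coeff {a b n : ℝ} (ha : 2 ≤ a) (hab : a ≤ b) (hb : b = 2 ∨ 3 ≤ b)
    (hn : (a + 2 * b) * (a + b - 2) + 2 ≤ b * n) :
    (a + 2 * b - 1) * (n - 1) ≤ (a + b - 1) * (b * n - (a + b)) := by
  rcases hb with rfl | hb
  · obtain rfl : a = 2 := le_antisymm hab ha
    linarith
  -- The right side is the coefficient of `n` in the claim. The bound fails for `a = b = 2`, where
  -- the claim is just `n ≥ 7`.
  · have hc : b ≤ a * b + b ^ 2 - 3 * b - a + 1 := by nlinarith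
    have k1 := mul_le_mul_of_nonneg_left hn (show 0 ≤ a * b + b ^ 2 - 3 * b - a + 1 by linarith)
    have k2 := mul_le_mul_of_nonneg_right hc
      (show 0 ≤ (a + 2 * b) * (a + b - 2) + 2 by nlinarith)
    have k3 : 0 ≤ b * (b * (a + b) - b + 1) := by
      have : 0 ≤ b * (a + b - 1) := mul_nonneg (by linarith) (by linarith)
      exact mul_nonneg (by linarith) (by linarith)
    refine le_of_mul_le_mul_left (a := b) ?_ (by linarith)
    linarith

/-- The arithmetic contradiction when some vertex is isolated outside the cut. -/
theorem cut_arith_zero {a b n i s y β : ℝ} (ha : 2 ≤ a) (hab : a ≤ b) (hb : b = 2 ∨ 3 ≤ b)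
    (hn : (a + 2 * b) * (a + b - 2) + 2 ≤ b * n)
    (hi : (a + 2 * b - 1) * i < b * n - (a + b))
    (hd : (a + b - 1) * n + (a + b) < (a + 2 * b - 1) * (s + i))
    (hβ : (a + 2 * b - 1) * (n - 1) < β * (b * n - (a + b)))
    (hx : 0 ≤ n - i - s) (hy : β * (n - i - s) ≤ n - y) :
    1 < b * s - y - (a - 1) * (n - i - s) := by
  have hD : 0 < a + 2 * b - 1 := by linarith
  have hE : 0 < b * n - (a + b) := by nlinarith
  have hc := cut_arith_coeff ha hab hb hn
  have k1 := mul_le_mul_of_nonneg_left hd.le (sub_nonneg.mpr hc)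
  have k2 := mul_lt_mul_of_pos_left hi (mul_pos (show 0 < b by linarith) hE)
  have k3 := mul_le_mul_of_nonneg_right hβ.le hx
  have k4 := mul_le_mul_of_nonneg_left hy hE.le
  have k5 : (a + 2 * b - 1) * ((a + 2 * b - 1) * (n - 1) * (n - i - s)) ≤
      (a + 2 * b - 1) * ((b * n - (a + b)) * (n - y)) :=
    mul_le_mul_of_nonneg_left (by linarith) hD.le
  -- The final slack is `a + b - 2`, scaled by the positive denominators.
  have k6 : 0 ≤ (a + 2 * b - 1) * (b * n - (a + b)) * (a + b - 2) :=
    mul_nonneg (mul_pos hD hE).le (by linarith)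
  refine lt_of_mul_lt_mul_left (a := (a + 2 * b - 1) * (b * n - (a + b))) ?_ (mul_pos hD hE).le
  linarith

/-! ### The cut condition from the binding number -/

open Classical in
theorem cut_of_bindingNumber {V : Type*} [Fintype V] (G : SimpleGraph V) (a b : ℕ)
    (ha : 2 ≤ a) (hab : a ≤ b)
    (hn : ((a : ℝ) + 2 * b) * (a + b - 2) + 2 ≤ b * Fintype.card V)
    (hβ : ((a : ℝ) + 2 * b - 1) * (Fintype.card V - 1) <
      bindingNumber G * (b * Fintype.card V - (a + b)))
    {I S T : Finset V} (hI : G.IsIndepSet (I : Set V)) (hIS : Disjoint I S) (hIT : Disjoint I T)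
    (hST : Disjoint S T) :
    a * T.card + (if S.Nonempty then 2 else 0) ≤
      b * S.card + ∑ x ∈ T, (G.neighborFinset x \ (I ∪ S)).card := by
  have haR : (2 : ℝ) ≤ a := by exact_mod_cast ha
  have habR : (a : ℝ) ≤ b := by exact_mod_cast hab
  have hbR : (b : ℝ) = 2 ∨ (3 : ℝ) ≤ b := by
    rcases (ha.trans hab).eq_or_lt with h | h
    · left; exact_mod_cast h.symm
    · right; exact_mod_cast h
  have hE : (0 : ℝ) < b * Fintype.card V - (a + b) := by nlinarith
  -- As `b ≥ 2`, one vertex of `S` already pays for the forced edge.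
  have hS2 : (if S.Nonempty then 2 else 0) ≤ b * S.card := by
    split_ifs with h
    · have := h.card_pos
      nlinarith
    · exact Nat.zero_le _
  rcases T.eq_empty_or_nonempty with rfl | hT
  · simpa using hS2
  obtain ⟨x₁, hx₁, hmin⟩ :=
    Finset.exists_min_image T (fun x => (G.neighborFinset x \ (I ∪ S)).card) hT
  set h := (G.neighborFinset x₁ \ (I ∪ S)).card with hh
  rcases le_or_gt a h with hah | hha
  · have : a * T.card ≤ ∑ x ∈ T, (G.neighborFinset x \ (I ∪ S)).card := by
      rw [mul_comm, ← smul_eq_mul]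
      exact Finset.card_nsmul_le_sum _ _ _ fun x hx => hah.trans (hmin x hx)
    omega
  have hcardpos : (1 : ℝ) ≤ Fintype.card V := by
    exact_mod_cast Fintype.card_pos_iff.mpr ⟨x₁⟩
  have hD : (0 : ℝ) < (a : ℝ) + 2 * b - 1 := by linarith
  have hβ0 : 0 ≤ bindingNumber G := by
    by_contra hneg
    have h1 := mul_neg_of_neg_of_pos (not_le.mp hneg) hE
    have h2 := mul_nonneg hD.le (sub_nonneg.mpr hcardpos)
    linarith
  -- A lower bound on every degree, written as an upper bound on the number of non-neighbours.
  have hdeg : ∀ x : V, ((a : ℝ) + 2 * b - 1) * (Fintype.card V - (G.neighborFinset x).card) <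
      b * Fintype.card V - (a + b) := by
    intro x
    have hx := bindingNumber_mul_sub_degree_le G x
    have hβpos : 0 < bindingNumber G := by
      rcases hβ0.eq_or_lt with h0 | h0
      · rw [← h0, zero_mul] at hβ
        have h2 := mul_nonneg hD.le (sub_nonneg.mpr hcardpos)
        linarith
      · exact h0
    refine lt_of_mul_lt_mul_left (a := bindingNumber G) ?_ hβ0
    have := mul_le_mul_of_nonneg_left hx hD.le
    linarith
  have hi : ((a : ℝ) + 2 * b - 1) * I.card < b * Fintype.card V - (a + b) := by
    rcases I.eq_empty_or_nonempty with rfl | ⟨x, hx⟩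
    · simpa using hE
    · refine lt_of_le_of_lt (mul_le_mul_of_nonneg_left ?_ hD.le) (hdeg x)
      have : Disjoint I (G.neighborFinset x) := by
        rw [Finset.disjoint_left]
        intro y hy hxy
        rw [SimpleGraph.mem_neighborFinset] at hxy
        exact hI hx hy hxy.ne hxy
      have h2 := Finset.card_le_univ (I ∪ G.neighborFinset x)
      rw [Finset.card_union_of_disjoint this] at h2
      have h3 : (I.card : ℝ) + (G.neighborFinset x).card ≤ Fintype.card V := by exact_mod_cast h2
      linarith
  have hd : ((a : ℝ) + b - 1) * Fintype.card V + (a + b) <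
      ((a : ℝ) + 2 * b - 1) * (h + S.card + I.card) := by
    have h1 : (G.neighborFinset x₁).card ≤ h + S.card + I.card := by
      have e1 := Finset.le_card_sdiff (I ∪ S) (G.neighborFinset x₁)
      have e2 := Finset.card_union_le I S
      omega
    have h1' : ((G.neighborFinset x₁).card : ℝ) ≤ h + S.card + I.card := by exact_mod_cast h1
    have := mul_le_mul_of_nonneg_left h1' hD.le
    linarith [hdeg x₁]
  have hdisjIS : Disjoint (I ∪ S) T := Finset.disjoint_union_left.mpr ⟨hIT, hST⟩
  have htle : (T.card : ℝ) ≤ Fintype.card V - I.card - S.card := by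
    have h2 := Finset.card_le_univ (I ∪ S ∪ T)
    rw [Finset.card_union_of_disjoint hdisjIS, Finset.card_union_of_disjoint hIS] at h2
    have h3 : (I.card : ℝ) + S.card + T.card ≤ Fintype.card V := by exact_mod_cast h2
    linarith
  -- By integrality, a strict excess over `1` gives the required `2`.
  suffices hsuf : (a : ℝ) * T.card + 1 <
      b * S.card + ∑ x ∈ T, ((G.neighborFinset x \ (I ∪ S)).card : ℝ) by
    have : a * T.card + 1 < b * S.card + ∑ x ∈ T, (G.neighborFinset x \ (I ∪ S)).card := by
      exact_mod_cast hsuf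
    split_ifs <;> omega
  rcases Nat.eq_zero_or_pos h with h0 | hpos
  -- No vertex outside `I ∪ S` is adjacent to `Y`, so the binding number bounds `Y`; every other
  -- vertex of `T` contributes at least `1` to the degree sum.
  · set Y := T.filter fun x => (G.neighborFinset x \ (I ∪ S)).card = 0 with hY
    have hYne : Y.Nonempty := ⟨x₁, by rw [hY, Finset.mem_filter]; exact ⟨hx₁, h0⟩⟩
    have hXne : (I ∪ S)ᶜ.Nonempty :=
      ⟨x₁, Finset.mem_compl.mpr (Finset.disjoint_right.mp hdisjIS hx₁)⟩
    have hy := bindingNumber_mul_card_le G hXne hYne (by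
      intro x hx y hy hadj
      rw [hY, Finset.mem_filter, Finset.card_eq_zero, Finset.sdiff_eq_empty_iff_subset] at hy
      exact Finset.mem_compl.mp hx (hy.2 (by simpa using hadj.symm)))
    rw [Finset.card_compl, Nat.cast_sub (Finset.card_le_univ _),
      Finset.card_union_of_disjoint hIS, Nat.cast_add, ← sub_sub] at hy
    rw [h0, Nat.cast_zero, zero_add] at hd
    have hx0 : (0 : ℝ) ≤ Fintype.card V - I.card - S.card := le_trans (Nat.cast_nonneg _) htle
    have hmain := cut_arith_zero haR habR hbR hn hi hd hβ hx0 hy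
    have hsum : (T.card : ℝ) ≤
        ∑ x ∈ T, ((G.neighborFinset x \ (I ∪ S)).card : ℝ) + Y.card := by
      have : ∑ x ∈ T, 1 ≤ ∑ x ∈ T, ((G.neighborFinset x \ (I ∪ S)).card +
          if (G.neighborFinset x \ (I ∪ S)).card = 0 then 1 else 0) := by
        refine Finset.sum_le_sum fun x _ => ?_
        split_ifs <;> omega
      rw [Finset.sum_add_distrib, Finset.sum_boole] at this
      simp only [Finset.sum_const, smul_eq_mul, mul_one] at this
      exact_mod_cast this
    have := mul_le_mul_of_nonneg_left htle (show (0 : ℝ) ≤ a - 1 by linarith)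
    linarith
  · have h1R : (1 : ℝ) ≤ h := by exact_mod_cast hpos
    have hhaR : (h : ℝ) ≤ a := by exact_mod_cast hha.le
    have hmain := cut_arith_pos haR habR h1R hhaR hn hi hd
    have hsum : (h : ℝ) * T.card ≤ ∑ x ∈ T, ((G.neighborFinset x \ (I ∪ S)).card : ℝ) := by
      have : T.card • h ≤ ∑ x ∈ T, (G.neighborFinset x \ (I ∪ S)).card :=
        Finset.card_nsmul_le_sum _ _ _ fun x hx => hmin x hx
      rw [smul_eq_mul, mul_comm] at this
      exact_mod_cast this
    have := mul_le_mul_of_nonneg_left htle (show (0 : ℝ) ≤ a - h by linarith)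
    linarith

/-! ### Transfer to the induced subgraph -/

theorem map_neighborFinset_induce {V : Type*} [DecidableEq V] (G : SimpleGraph V) (I : Finset V)
    [DecidableEq ↥((I : Set V)ᶜ)] (S : Finset ↥((I : Set V)ᶜ)) (x : ↥((I : Set V)ᶜ))
    [Fintype (G.neighborSet x.1)] [Fintype ((G.induce ((I : Set V)ᶜ)).neighborSet x)] :
    ((G.induce ((I : Set V)ᶜ)).neighborFinset x \ S).map (Function.Embedding.subtype _) =
      G.neighborFinset x.1 \ (I ∪ S.map (Function.Embedding.subtype _)) := by
  ext v
  simp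
  tauto

end FracCovered

theorem theorem2 {V : Type*} [Fintype V] (G : SimpleGraph V) (a b n : ℕ)
    (ha : 2 ≤ a) (hab : a ≤ b) (hcard : Fintype.card V = n)
    (hn : (n : ℝ) ≥ (((a : ℝ) + 2 * b) * ((a : ℝ) + b - 2) + 2) / b)
    (hbind : FracCovered.bindingNumber G >
      ((a : ℝ) + 2 * b - 1) * ((n : ℝ) - 1) / ((b : ℝ) * n - ((a : ℝ) + b))) :
    FracCovered.IsFractionalIDFactorCriticalCovered G a b := by
  classical
  subst hcard
  have haR : (2 : ℝ) ≤ a := by exact_mod_cast ha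
  have habR : (a : ℝ) ≤ b := by exact_mod_cast hab
  rw [ge_iff_le, div_le_iff₀ (by linarith), mul_comm (Fintype.card V : ℝ)] at hn
  have hE : (0 : ℝ) < b * Fintype.card V - (a + b) := by nlinarith
  rw [gt_iff_lt, div_lt_iff₀ hE] at hbind
  intro I hI
  obtain ⟨I, rfl⟩ : ∃ J : Finset V, (J : Set V) = I := ⟨I.toFinset, by simp⟩
  refine FracCovered.isFractionalCovered_of_cut _ a b hab fun S T hST => ?_
  have h := FracCovered.cut_of_bindingNumber G a b ha hab hn hbind hI
    (S := S.map (Function.Embedding.subtype _)) (T := T.map (Function.Embedding.subtype _))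
    (by rw [Finset.disjoint_right]; simp +contextual)
    (by rw [Finset.disjoint_right]; simp +contextual)
    ((Finset.disjoint_map _).mpr hST)
  simp only [Finset.card_map, Finset.map_nonempty, Finset.sum_map] at h
  refine h.trans (Nat.add_le_add_left (Finset.sum_le_sum fun x _ => ?_) _)
  refine le_of_eq ?_
  rw [Function.Embedding.subtype_apply, ← Finset.card_map (Function.Embedding.subtype _)]
  refine (congrArg Finset.card ?_).symm
  convert FracCovered.map_neighborFinset_induce G I S x
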